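/- Let $G$ be a finite simple graph with vertex set $V$. For $X,Y\subseteq V$ (not necessarily disjoint), let $e(X,Y)$ be the number of ordered pairs $(x,y)\in X\times Y$ with $xy$ an edge of $G$. For nonempty $X,Y$ let $d(X,Y)=e(X,Y)/(|X||Y|)$ and $$\operatorname{irreg}(X,Y)=\max_{U\subseteq X,\ W\subseteq Y}\bigl|e(U,W)-|U||W|\,d(X,Y)\bigr|.$$ For a partition $\mathcal P$ of $V$ into nonempty parts let $\operatorname{irreg}(\mathcal P)=\sum_{X,Y\in\mathcal P}\operatorname{irreg}(X,Y)$, the sum being over all ordered pairs of parts, including $X=Y$. A partition is equitable if the sizes of any two of its parts differ by at most one. Theorem. Let $0<\alpha<1/2$, let $m$ be a positive integer, and let $G$ be a graph on $n\ge 10^8m\alpha^{-5}$ vertices. If $\mathcal P$ is a partition of the vertex set of $G$ into $m$ parts, then there is an equitable partition $\mathcal Q$ of the vertex set of $G$ into at most $4m/\alpha$ parts such that $\operatorname{irreg}(\mathcal Q)\le\operatorname{irreg}(\mathcal P)+\alpha n^2$. -/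

import Mathlib

namespace SimpleGraph

variable {V : Type*} (G : SimpleGraph V) [DecidableRel G.Adj]

/-- The irregularity of a pair of vertex sets,
`irreg(X, Y) = max_{U ⊆ X, W ⊆ Y} |e(U, W) - |U| |W| d(X, Y)|`, where `e(U, W)` is the number of
ordered pairs in `U × W` that are edges and `d(X, Y) = e(X, Y) / (|X| |Y|)`. -/
noncomputable def pairIrreg (X Y : Finset V) : ℝ :=
  (X.powerset ×ˢ Y.powerset).sup'
    ⟨(∅, ∅), Finset.mem_product.2 ⟨Finset.empty_mem_powerset X, Finset.empty_mem_powerset Y⟩⟩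
    (fun p => |((G.interedges p.1 p.2).card : ℝ)
      - (p.1.card : ℝ) * (p.2.card : ℝ) * ((G.edgeDensity X Y : ℚ) : ℝ)|)

/-- The irregularity of a vertex partition: the sum of `irreg(X, Y)` over all ordered pairs of
(not necessarily distinct) parts. -/
noncomputable def partitionIrreg [Fintype V] [DecidableEq V]
    (P : Finpartition (Finset.univ : Finset V)) : ℝ :=
  ∑ X ∈ P.parts, ∑ Y ∈ P.parts, G.pairIrreg X Y

end SimpleGraph

/-!
Take an equipartition `Q` such that only few vertices lie in parts of `Q` contained in no part of
`P`, and move `Q` by a random permutation that preserves each part of `P`. For parts `S ≠ T` of `Q`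
contained in parts `X` and `Y` of `P`, let `A` be the adjacency matrix shifted by the density of
`(X, Y)`. Its cut norm on `X × Y` is `irreg(X, Y)`, and its cut norm on a random `S × T`, together
with its total sum there, bounds the irregularity of the pair `(S, T)`.

Sampling `T` and then `S` without replacement scales the expected cut norm by `|S| |T| / (|X| |Y|)`
up to an error. Comparing with an independent sample and exchanging the two at random bounds this
error by a Rademacher average, and the contraction principle removes the positive parts that arise
from maximizing over columns. What remains is linear in the rows, of order `|S| √|T|`, so the main
terms add up to at most `irreg(P)`. The trivial bound `irreg(S, T) ≤ |S| |T| / 4` deals with the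
diagonal pairs and with the parts of `Q` that cross between parts of `P`.
-/

open Finset Equiv
open scoped BigOperators

section Rademacher

variable {ι β : Type*}

/-- The Rademacher sum of the numbers `b y`, `y ∈ T`, with signs `ε y`. -/
def signedSum (ε : β → ℤˣ) (T : Finset β) (b : β → ℝ) : ℝ := ∑ y ∈ T, ((ε y : ℤ) : ℝ) * b y

theorem signedSum_neg (ε : β → ℤˣ) (T : Finset β) (b : β → ℝ) :
    signedSum (-ε) T b = -signedSum ε T b := by
  simp [signedSum]

theorem signedSum_sub (ε : β → ℤˣ) (T : Finset β) (b c : β → ℝ) :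
    signedSum ε T (fun y => b y - c y) = signedSum ε T b - signedSum ε T c := by
  simp [signedSum, mul_sub]

variable [DecidableEq β]

/-- The sign pattern `ε` with its sign at `a` reversed. -/
def flipSign (a : β) (ε : β → ℤˣ) : β → ℤˣ := ε * Pi.mulSingle a (-1)

theorem flipSign_self (a : β) (ε : β → ℤˣ) : flipSign a ε a = -ε a := by
  simp [flipSign]

theorem flipSign_of_ne {a y : β} (h : y ≠ a) (ε : β → ℤˣ) : flipSign a ε y = ε y := by
  simp [flipSign, Pi.mulSingle_eq_of_ne h]

theorem signedSum_insert {a : β} {T : Finset β} (ha : a ∉ T) (ε : β → ℤˣ) (b : β → ℝ) :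
    signedSum ε (insert a T) b = ((ε a : ℤ) : ℝ) * b a + signedSum ε T b :=
  sum_insert ha

theorem signedSum_flipSign_insert {a : β} {T : Finset β} (ha : a ∉ T) (ε : β → ℤˣ) (b : β → ℝ) :
    signedSum (flipSign a ε) (insert a T) b = -(((ε a : ℤ) : ℝ) * b a) + signedSum ε T b := by
  have hT : signedSum (flipSign a ε) T b = signedSum ε T b :=
    sum_congr rfl fun y hy => by rw [flipSign_of_ne (ne_of_mem_of_not_mem hy ha)]
  simp [signedSum_insert ha, hT, flipSign_self]

variable [Fintype β]

theorem expect_eq_expect_add_flipSign (a : β) (F : (β → ℤˣ) → ℝ) :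
    𝔼 ε, F ε = 𝔼 ε, (F ε + F (flipSign a ε)) / 2 := by
  have hflip : 𝔼 ε, F (flipSign a ε) = 𝔼 ε, F ε :=
    Fintype.expect_equiv (Equiv.mulRight (Pi.mulSingle a (-1))) _ _ fun _ => rfl
  rw [← expect_div, expect_add_distrib, hflip]
  ring

theorem expect_signedSum_sq (b : β → ℝ) (T : Finset β) :
    𝔼 ε, signedSum ε T b ^ 2 = ∑ y ∈ T, b y ^ 2 := by
  induction T using Finset.induction_on with
  | empty => simp [signedSum]
  | insert a T ha ih =>
    have hpair (ε : β → ℤˣ) : (signedSum ε (insert a T) b ^ 2 +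
        signedSum (flipSign a ε) (insert a T) b ^ 2) / 2 = b a ^ 2 + signedSum ε T b ^ 2 := by
      have hε : ((ε a : ℤ) : ℝ) ^ 2 = 1 := by exact_mod_cast Int.isUnit_sq (ε a).isUnit
      rw [signedSum_insert ha, signedSum_flipSign_insert ha]
      linear_combination b a ^ 2 * hε
    rw [expect_eq_expect_add_flipSign a]
    simp only [hpair]
    rw [expect_add_distrib, Fintype.expect_const, ih, sum_insert ha]

theorem expect_abs_signedSum_le {b : β → ℝ} {T : Finset β} (hb : ∀ y ∈ T, |b y| ≤ 1) :
    𝔼 ε, |signedSum ε T b| ≤ √(#T) := by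
  refine Real.le_sqrt_of_sq_le ?_
  calc (𝔼 ε, |signedSum ε T b|) ^ 2
      ≤ 𝔼 ε, |signedSum ε T b| ^ 2 := by
        simp only [expect_eq_sum_div_card]
        exact sum_div_card_sq_le_sum_sq_div_card
    _ = ∑ y ∈ T, b y ^ 2 := by simp_rw [sq_abs, expect_signedSum_sq]
    _ ≤ ∑ _y ∈ T, 1 := sum_le_sum fun y hy => (sq_le_one_iff_abs_le_one _).2 (hb y hy)
    _ = #T := by simp

/-- The Rademacher average of the family `f` on the index set `T`: the expected supremum over the
family of a Rademacher sum with independent uniform signs. -/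
noncomputable def rademacherAvg (f : ι → β → ℝ) (T : Finset β) : ℝ :=
  𝔼 ε, ⨆ i, signedSum ε T (f i)

theorem rademacherAvg_linear_le {α : Type*} [Nonempty ι] {S : Finset α} {T : Finset β}
    {B : α → β → ℝ} (hB : ∀ x y, |B x y| ≤ 1) {c : ι → α → ℝ} (hc : ∀ i x, |c i x| ≤ 1) :
    rademacherAvg (fun i y => ∑ x ∈ S, c i x * B x y) T ≤ #S * √(#T) := by
  have hsup (ε : β → ℤˣ) : ⨆ i, signedSum ε T (fun y => ∑ x ∈ S, c i x * B x y) ≤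
      ∑ x ∈ S, |signedSum ε T (B x)| := by
    refine ciSup_le fun i => ?_
    calc signedSum ε T (fun y => ∑ x ∈ S, c i x * B x y)
        = ∑ x ∈ S, c i x * signedSum ε T (B x) := by
          simp only [signedSum, mul_sum]
          rw [sum_comm]
          simp only [mul_left_comm]
      _ ≤ ∑ x ∈ S, |signedSum ε T (B x)| := sum_le_sum fun x _ =>
          (le_abs_self _).trans <| by
            rw [abs_mul]
            exact mul_le_of_le_one_left (abs_nonneg _) (hc i x)
  calc rademacherAvg (fun i y => ∑ x ∈ S, c i x * B x y) T
      ≤ ∑ x ∈ S, 𝔼 ε, |signedSum ε T (B x)| := by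
        rw [← expect_sum_comm]
        exact expect_le_expect fun ε _ => hsup ε
    _ ≤ #S • √(#T) :=
        sum_le_card_nsmul _ _ _ fun x _ => expect_abs_signedSum_le fun y _ => hB x y
    _ = #S * √(#T) := nsmul_eq_mul _ _

variable [Finite ι] [Nonempty ι]

theorem ciSup_add_add_ciSup_neg_add_le {u v : ι → ℝ} (w : ι → ℝ)
    (h : ∀ i j, |u i - u j| ≤ |v i - v j|) :
    (⨆ i, (u i + w i)) + (⨆ i, (-u i + w i)) ≤ (⨆ i, (v i + w i)) + ⨆ i, (-v i + w i) := by
  obtain ⟨i, hi⟩ := exists_eq_ciSup_of_finite (f := fun i => u i + w i)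
  obtain ⟨j, hj⟩ := exists_eq_ciSup_of_finite (f := fun i => -u i + w i)
  have hpos (k) : v k + w k ≤ ⨆ i, (v i + w i) :=
    le_ciSup (f := fun i => v i + w i) (Set.finite_range _).bddAbove k
  have hneg (k) : -v k + w k ≤ ⨆ i, (-v i + w i) :=
    le_ciSup (f := fun i => -v i + w i) (Set.finite_range _).bddAbove k
  have huv : u i - u j ≤ |v i - v j| := (le_abs_self _).trans (h i j)
  rw [← hi, ← hj]
  rcases abs_cases (v i - v j) with ⟨habs, -⟩ | ⟨habs, -⟩
  · linarith [hpos i, hneg j]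
  · linarith [hpos j, hneg i]

theorem rademacherAvg_update_le (f : ι → β → ℝ) (a : β) {u : ι → ℝ}
    (h : ∀ i j, |u i - u j| ≤ |f i a - f j a|) (T : Finset β) :
    rademacherAvg (fun i => Function.update (f i) a (u i)) T ≤ rademacherAvg f T := by
  have hoff {D : Finset β} (ha : a ∉ D) (ε : β → ℤˣ) (i : ι) :
      signedSum ε D (Function.update (f i) a (u i)) = signedSum ε D (f i) :=
    sum_congr rfl fun y hy => by rw [Function.update_of_ne (ne_of_mem_of_not_mem hy ha)]
  by_cases haT : a ∈ T
  · rw [← insert_erase haT]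
    have ha := notMem_erase a T
    unfold rademacherAvg
    rw [expect_eq_expect_add_flipSign a,
      expect_eq_expect_add_flipSign a fun ε => ⨆ i, signedSum ε _ (f i)]
    refine expect_le_expect fun ε _ => div_le_div_of_nonneg_right ?_ zero_le_two
    simp only [signedSum_flipSign_insert ha]
    simp only [signedSum_insert ha, hoff ha, Function.update_self]
    refine ciSup_add_add_ciSup_neg_add_le _ fun i j => ?_
    simp only [← mul_sub, abs_mul]
    exact mul_le_mul_of_nonneg_left (h i j) (abs_nonneg _)
  · simp only [rademacherAvg, hoff haT, le_refl]

/-- The Ledoux–Talagrand contraction principle. -/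
theorem rademacherAvg_le_of_abs_sub_le {f g : ι → β → ℝ}
    (h : ∀ i j y, |f i y - f j y| ≤ |g i y - g j y|) (T : Finset β) :
    rademacherAvg f T ≤ rademacherAvg g T := by
  -- Replace `g` by `f` one coordinate at a time.
  suffices hD : ∀ D : Finset β, rademacherAvg (fun i => D.piecewise (f i) (g i)) T ≤
      rademacherAvg g T by simpa using hD univ
  intro D
  induction D using Finset.induction_on with
  | empty => simp
  | insert a D ha ih =>
    simp only [piecewise_insert]
    refine (rademacherAvg_update_le _ a (fun i j => ?_) T).trans ih
    simpa only [piecewise_eq_of_notMem _ _ _ ha] using h i j a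

end Rademacher

section Sampling

variable {β : Type*} [DecidableEq β]

theorem exists_perm_swap {D : Finset β} {κ : β → β} (hκ : Set.InjOn κ D)
    (hD : Disjoint D (D.image κ)) :
    ∃ θ : Perm β, (∀ y ∈ D, θ y = κ y ∧ θ (κ y) = y) ∧ ∀ z ∉ D, z ∉ D.image κ → θ z = z := by
  induction D using Finset.induction_on with
  | empty => exact ⟨1, by simp⟩
  | insert a D ha ih =>
    simp only [coe_insert, Set.injOn_insert (mem_coe.not.2 ha), image_insert, disjoint_insert_left,
      disjoint_insert_right, mem_insert, not_or] at hκ hD ⊢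
    obtain ⟨⟨-, hκaD⟩, haD, hdisj⟩ := hD
    obtain ⟨θ, hswap, hfix⟩ := ih hκ.1 hdisj
    refine ⟨θ * swap a (κ a), ?_, fun z hz hzκ => ?_⟩
    · rintro y (rfl | hy)
      · exact ⟨by simpa using hfix _ hκaD (by simpa using hκ.2), by simpa using hfix _ ha haD⟩
      · have hκy := mem_image_of_mem κ hy
        rw [Perm.mul_apply, Perm.mul_apply,
          swap_apply_of_ne_of_ne (ne_of_mem_of_not_mem hy ha) (ne_of_mem_of_not_mem hy hκaD),
          swap_apply_of_ne_of_ne (ne_of_mem_of_not_mem hκy haD)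
            (ne_of_mem_of_not_mem hκy (by simpa using hκ.2))]
        exact hswap y hy
    · rw [Perm.mul_apply, swap_apply_of_ne_of_ne hz.1 hzκ.1]
      exact hfix z hz.2 hzκ.2

theorem exists_perm_sub_eq_sign_mul {D : Finset β} {κ : β → β} (hκ : Set.InjOn κ D)
    (hD : Disjoint D (D.image κ)) (ε : β → ℤˣ) :
    ∃ θ : Perm β, ∀ y ∈ D, ∀ g : β → ℝ,
      g (θ y) - g (θ (κ y)) = ((ε y : ℤ) : ℝ) * (g y - g (κ y)) := by
  set E := D.filter (ε · = -1)
  have hE : E ⊆ D := filter_subset _ _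
  obtain ⟨θ, hswap, hfix⟩ :=
    exists_perm_swap (hκ.mono hE) (hD.mono hE (image_subset_image hE))
  refine ⟨θ, fun y hy g => ?_⟩
  rcases Int.units_eq_one_or (ε y) with h | h
  · have hyE : y ∉ E := by simp [E, h]
    have hκyE : κ y ∉ E.image κ := by
      simp only [mem_image, not_exists, not_and]
      rintro z hz hzy
      exact hyE (hκ (hE hz) hy hzy ▸ hz)
    rw [hfix y hyE fun hy' => disjoint_left.1 hD hy (image_subset_image hE hy'),
      hfix _ (fun hy' => disjoint_left.1 hD (hE hy') (mem_image_of_mem κ hy)) hκyE]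
    simp [h]
  · obtain ⟨hy₁, hy₂⟩ := hswap y (by simp [E, h, hy])
    simp [hy₁, hy₂, h]

theorem exists_injOn_image_eq {D D' : Finset β} (h : #D = #D') :
    ∃ κ : β → β, Set.InjOn κ D ∧ D.image κ = D' := by
  rcases isEmpty_or_nonempty β
  · exact ⟨id, Function.injective_id.injOn, Subsingleton.elim _ _⟩
  obtain ⟨κ, hκ⟩ := D.finite_toSet.exists_bijOn_of_encard_eq (t := (D' : Set β)) (by simp [h])
  exact ⟨κ, hκ.injOn, by exact_mod_cast hκ.image_eq⟩

variable [Fintype β]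

theorem expect_perm_mul_right (θ : Perm β) (F : Perm β → ℝ) : 𝔼 τ, F (τ * θ) = 𝔼 τ, F τ :=
  Fintype.expect_equiv (Equiv.mulRight θ) _ _ fun _ => rfl

theorem expect_perm_apply (g : β → ℝ) (y : β) : 𝔼 τ : Perm β, g (τ y) = 𝔼 x, g x := by
  have : Nonempty β := ⟨y⟩
  have hind (z : β) : 𝔼 τ : Perm β, g (τ y) = 𝔼 τ : Perm β, g (τ z) := by
    rw [← expect_perm_mul_right (swap y z)]
    simp
  calc 𝔼 τ : Perm β, g (τ y)
      = 𝔼 z, 𝔼 τ : Perm β, g (τ z) := by simp only [← hind, Fintype.expect_const]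
    _ = 𝔼 τ : Perm β, 𝔼 z, g (τ z) := expect_comm ..
    _ = 𝔼 _τ : Perm β, 𝔼 x, g x :=
        expect_congr rfl fun τ _ => Fintype.expect_equiv τ _ _ fun _ => rfl
    _ = 𝔼 x, g x := Fintype.expect_const _

theorem expect_perm_sum (g : β → ℝ) (T : Finset β) :
    𝔼 τ : Perm β, ∑ y ∈ T, g (τ y) = #T / Fintype.card β * ∑ y, g y := by
  rw [expect_sum_comm]
  simp only [expect_perm_apply, sum_const, nsmul_eq_mul]
  rw [Fintype.expect_eq_sum_div_card]
  ring

variable {ι : Type*} [Finite ι] [Nonempty ι]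

/-- Exchanging `y` with `κ y` according to random signs preserves the uniform distribution. -/
theorem expect_perm_ciSup_sum_sub_le_of_injOn {f : ι → β → ℝ} {D : Finset β} {κ : β → β}
    (hκ : Set.InjOn κ D) (hD : Disjoint D (D.image κ)) {R : ℝ}
    (hR : ∀ g : β → β, rademacherAvg (fun i => f i ∘ g) D ≤ R) :
    𝔼 τ : Perm β, ⨆ i, ∑ y ∈ D, (f i (τ y) - f i (τ (κ y))) ≤ 2 * R := by
  have hsign (ε : β → ℤˣ) : 𝔼 τ : Perm β, ⨆ i, ∑ y ∈ D, (f i (τ y) - f i (τ (κ y))) =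
      𝔼 τ : Perm β, ⨆ i, signedSum ε D fun y => f i (τ y) - f i (τ (κ y)) := by
    obtain ⟨θ, hθ⟩ := exists_perm_sub_eq_sign_mul hκ hD ε
    rw [← expect_perm_mul_right θ]
    exact expect_congr rfl fun τ _ => iSup_congr fun i => sum_congr rfl fun y hy =>
      hθ y hy (f i ∘ τ)
  have hsplit (τ : Perm β) (ε : β → ℤˣ) :
      ⨆ i, signedSum ε D (fun y => f i (τ y) - f i (τ (κ y))) ≤
        (⨆ i, signedSum ε D (f i ∘ τ)) + ⨆ i, signedSum (-ε) D (f i ∘ τ ∘ κ) := by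
    simp only [signedSum_neg]
    refine (iSup_congr fun i => (signedSum_sub ε D (f i ∘ τ) (f i ∘ τ ∘ κ)).trans
      (sub_eq_add_neg _ _)).trans_le ?_
    exact ciSup_add_le_ciSup_add_ciSup (Set.finite_range _).bddAbove (Set.finite_range _).bddAbove
  have hneg (h : ι → β → ℝ) :
      𝔼 ε : β → ℤˣ, ⨆ i, signedSum (-ε) D (h i) = rademacherAvg h D :=
    Fintype.expect_equiv (Equiv.neg _) _ _ fun _ => rfl
  calc 𝔼 τ : Perm β, ⨆ i, ∑ y ∈ D, (f i (τ y) - f i (τ (κ y)))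
      = 𝔼 ε : β → ℤˣ, 𝔼 τ : Perm β, ⨆ i, signedSum ε D fun y => f i (τ y) - f i (τ (κ y)) := by
        simp only [← hsign, Fintype.expect_const]
    _ = 𝔼 τ : Perm β, 𝔼 ε : β → ℤˣ, ⨆ i, signedSum ε D fun y => f i (τ y) - f i (τ (κ y)) :=
        expect_comm ..
    _ ≤ 2 * R := by
        refine expect_le univ_nonempty fun τ _ => ?_
        calc 𝔼 ε : β → ℤˣ, ⨆ i, signedSum ε D (fun y => f i (τ y) - f i (τ (κ y)))
            ≤ rademacherAvg (fun i => f i ∘ τ) D + rademacherAvg (fun i => f i ∘ τ ∘ κ) D := by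
              rw [← hneg (fun i => f i ∘ τ ∘ κ), rademacherAvg, ← expect_add_distrib]
              exact expect_le_expect fun ε _ => hsplit τ ε
          _ ≤ 2 * R := by linarith [hR τ, hR (τ ∘ κ)]

theorem expect_perm_ciSup_sum_sub_le {f : ι → β → ℝ} {T : Finset β} {R : ℝ}
    (hR : ∀ D ⊆ T, ∀ g : β → β, rademacherAvg (fun i => f i ∘ g) D ≤ R) (ρ : Perm β) :
    𝔼 τ : Perm β, ⨆ i, (∑ y ∈ T, f i (τ y) - ∑ y ∈ T, f i (τ (ρ y))) ≤ 2 * R := by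
  have hcard : #(T \ T.image ρ) = #(T.image ρ \ T) :=
    card_sdiff_comm (card_image_of_injective T ρ.injective).symm
  obtain ⟨κ, hκ, hκT⟩ := exists_injOn_image_eq hcard
  have hdisj : Disjoint (T \ T.image ρ) ((T \ T.image ρ).image κ) :=
    hκT ▸ disjoint_sdiff_sdiff
  have hdiff (h : β → ℝ) : ∑ y ∈ T, h y - ∑ y ∈ T, h (ρ y) =
      ∑ y ∈ T \ T.image ρ, (h y - h (κ y)) := by
    rw [← sum_image ρ.injective.injOn, ← sum_sdiff_sub_sum_sdiff, sum_sub_distrib,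
      ← sum_image hκ, hκT]
  simp only [fun i (τ : Perm β) => hdiff (f i ∘ τ), ← Function.comp_apply (f := f _)]
  exact expect_perm_ciSup_sum_sub_le_of_injOn hκ hdisj (hR _ sdiff_subset)

theorem expect_perm_ciSup_le {f : ι → β → ℝ} {T : Finset β} {R : ℝ}
    (hR : ∀ D ⊆ T, ∀ g : β → β, rademacherAvg (fun i => f i ∘ g) D ≤ R) :
    𝔼 τ : Perm β, ⨆ i, ∑ y ∈ T, f i (τ y) ≤
      #T / Fintype.card β * (⨆ i, ∑ y, f i y) + 2 * R := by
  set p : ℝ := #T / Fintype.card β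
  -- Jensen's inequality: the mean is an average over a second, independent permutation `ρ`.
  have hmean (τ : Perm β) : ⨆ i, ∑ y ∈ T, f i (τ y) ≤ p * (⨆ i, ∑ y, f i y) +
      𝔼 ρ : Perm β, ⨆ i, (∑ y ∈ T, f i (τ y) - ∑ y ∈ T, f i (τ (ρ y))) := by
    refine ciSup_le fun i => ?_
    calc ∑ y ∈ T, f i (τ y)
        = p * ∑ y, f i y + 𝔼 ρ : Perm β, (∑ y ∈ T, f i (τ y) - ∑ y ∈ T, f i (τ (ρ y))) := by
          rw [expect_sub_distrib, Fintype.expect_const, expect_perm_sum fun y => f i (τ y),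
            Equiv.sum_comp τ (f i)]
          ring
      _ ≤ _ := by
          gcongr with ρ
          · exact le_ciSup (f := fun i => ∑ y, f i y) (Set.finite_range _).bddAbove i
          · exact le_ciSup (f := fun i => ∑ y ∈ T, f i (τ y) - ∑ y ∈ T, f i (τ (ρ y)))
              (Set.finite_range _).bddAbove i
  calc 𝔼 τ : Perm β, ⨆ i, ∑ y ∈ T, f i (τ y)
      ≤ p * (⨆ i, ∑ y, f i y) + 𝔼 ρ : Perm β, 𝔼 τ : Perm β,
          ⨆ i, (∑ y ∈ T, f i (τ y) - ∑ y ∈ T, f i (τ (ρ y))) := by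
        rw [expect_comm, ← Fintype.expect_const (ι := Perm β) (p * ⨆ i, ∑ y, f i y),
          ← expect_add_distrib]
        exact expect_le_expect fun τ _ => hmean τ
    _ ≤ p * (⨆ i, ∑ y, f i y) + 2 * R := by
        gcongr
        exact expect_le univ_nonempty fun ρ _ => expect_perm_ciSup_sum_sub_le hR ρ

theorem expect_perm_ciSup_matrix_le {α : Type*} {S : Finset α} (T : Finset β) {B : α → β → ℝ}
    (hB : ∀ x y, |B x y| ≤ 1) {c : ι → α → ℝ} (hc : ∀ i x, |c i x| ≤ 1) {ψ : ℝ → ℝ}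
    (hψ : ∀ a b, |ψ a - ψ b| ≤ |a - b|) :
    𝔼 τ : Perm β, ⨆ i, ∑ y ∈ T, ψ (∑ x ∈ S, c i x * B x (τ y)) ≤
      #T / Fintype.card β * (⨆ i, ∑ y, ψ (∑ x ∈ S, c i x * B x y)) + 2 * (#S * √(#T)) := by
  refine expect_perm_ciSup_le (f := fun i y => ψ (∑ x ∈ S, c i x * B x y)) fun D hD g => ?_
  calc rademacherAvg (fun i => (fun y => ψ (∑ x ∈ S, c i x * B x y)) ∘ g) D
      ≤ rademacherAvg (fun i y => ∑ x ∈ S, c i x * B x (g y)) D :=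
        rademacherAvg_le_of_abs_sub_le (fun _ _ _ => hψ _ _) D
    _ ≤ #S * √(#D) := rademacherAvg_linear_le (fun x y => hB x (g y)) hc
    _ ≤ #S * √(#T) := by gcongr

end Sampling

section CutNorm

variable {α β α' β' : Type*}

/-- The cut norm of the submatrix of `B` with rows `S` and columns `T`: the largest absolute value
of the sum of the entries of a further submatrix. It is taken without normalization. -/
noncomputable def cutNorm (B : α → β → ℝ) (S : Finset α) (T : Finset β) : ℝ :=
  (S.powerset ×ˢ T.powerset).sup' ⟨(∅, ∅), by simp⟩ fun p => |∑ x ∈ p.1, ∑ y ∈ p.2, B x y|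

theorem abs_sum_le_cutNorm (B : α → β → ℝ) {S U : Finset α} {T W : Finset β} (hU : U ⊆ S)
    (hW : W ⊆ T) : |∑ x ∈ U, ∑ y ∈ W, B x y| ≤ cutNorm B S T :=
  le_sup' (fun p : Finset α × Finset β => |∑ x ∈ p.1, ∑ y ∈ p.2, B x y|)
    (b := (U, W)) (by simp [hU, hW])

theorem cutNorm_le {B : α → β → ℝ} {S : Finset α} {T : Finset β} {r : ℝ}
    (h : ∀ U ⊆ S, ∀ W ⊆ T, |∑ x ∈ U, ∑ y ∈ W, B x y| ≤ r) : cutNorm B S T ≤ r :=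
  sup'_le _ _ fun _ hp =>
    h _ (mem_powerset.1 (mem_product.1 hp).1) _ (mem_powerset.1 (mem_product.1 hp).2)

theorem cutNorm_mono_right (B : α → β → ℝ) (S : Finset α) {T T' : Finset β} (h : T ⊆ T') :
    cutNorm B S T ≤ cutNorm B S T' :=
  cutNorm_le fun _ hU _ hW => abs_sum_le_cutNorm B hU (hW.trans h)

theorem cutNorm_transpose_le (B : α → β → ℝ) (S : Finset α) (T : Finset β) :
    cutNorm (fun y x => B x y) T S ≤ cutNorm B S T :=
  cutNorm_le fun _ hU _ hW => by
    rw [sum_comm]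
    exact abs_sum_le_cutNorm B hW hU

theorem cutNorm_transpose (B : α → β → ℝ) (S : Finset α) (T : Finset β) :
    cutNorm (fun y x => B x y) T S = cutNorm B S T :=
  (cutNorm_transpose_le B S T).antisymm (cutNorm_transpose_le (fun y x => B x y) T S)

theorem cutNorm_map (B : α → β → ℝ) (S : Finset α') (T : Finset β') (e : α' ↪ α) (e' : β' ↪ β) :
    cutNorm B (S.map e) (T.map e') = cutNorm (fun x y => B (e x) (e' y)) S T := by
  refine le_antisymm (cutNorm_le fun U hU W hW => ?_) (cutNorm_le fun U hU W hW => ?_)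
  · obtain ⟨U, hUS, rfl⟩ := subset_map_iff.1 hU
    obtain ⟨W, hWT, rfl⟩ := subset_map_iff.1 hW
    simp only [sum_map]
    exact abs_sum_le_cutNorm (fun x y => B (e x) (e' y)) hUS hWT
  · simpa only [sum_map] using
      abs_sum_le_cutNorm B (map_subset_map (f := e).2 hU) (map_subset_map (f := e').2 hW)

theorem intUnit_mul_le_abs (s : ℤˣ) (z : ℝ) : ((s : ℤ) : ℝ) * z ≤ |z| := by
  rcases Int.units_eq_one_or s with rfl | rfl
  · simpa using le_abs_self z
  · simpa using neg_le_abs z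

theorem exists_intUnit_mul_eq_abs (z : ℝ) : ∃ s : ℤˣ, ((s : ℤ) : ℝ) * z = |z| := by
  rcases abs_choice z with h | h
  · exact ⟨1, by simp [h]⟩
  · exact ⟨-1, by simp [h]⟩

theorem abs_eq_ciSup_intUnit_mul (z : ℝ) : |z| = ⨆ s : ℤˣ, ((s : ℤ) : ℝ) * z := by
  refine le_antisymm ?_ (ciSup_le fun s => intUnit_mul_le_abs s z)
  obtain ⟨s, hs⟩ := exists_intUnit_mul_eq_abs z
  exact hs ▸ le_ciSup (f := fun s : ℤˣ => ((s : ℤ) : ℝ) * z) (Set.finite_range _).bddAbove s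

theorem sum_max_zero (b : β → ℝ) (T : Finset β) :
    ∑ y ∈ T, max (b y) 0 = ∑ y ∈ T with 0 ≤ b y, b y := by
  rw [sum_filter]
  refine sum_congr rfl fun y _ => ?_
  split_ifs with h
  · exact max_eq_left h
  · exact max_eq_right (le_of_not_ge h)

theorem sum_le_sum_max_zero (b : β → ℝ) {T W : Finset β} (hW : W ⊆ T) :
    ∑ y ∈ W, b y ≤ ∑ y ∈ T, max (b y) 0 :=
  (sum_le_sum fun y _ => le_max_left (b y) 0).trans
    (sum_le_sum_of_subset_of_nonneg hW fun _ _ _ => le_max_right _ _)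

variable [DecidableEq α]

theorem sum_ite_mem_mul {S U : Finset α} (hU : U ⊆ S) (r : ℝ) (b : α → ℝ) :
    ∑ x ∈ S, (if x ∈ U then r else 0) * b x = r * ∑ x ∈ U, b x := by
  simp only [ite_mul, zero_mul]
  rw [sum_ite_mem, inter_eq_right.2 hU, mul_sum]

/-- Once the rows and the sign are fixed, the best columns are those with a positive sum. -/
theorem cutNorm_eq_ciSup (B : α → β → ℝ) (S : Finset α) (T : Finset β) :
    cutNorm B S T = ⨆ i : S.powerset × ℤˣ, ∑ y ∈ T,
      max (∑ x ∈ S, (if x ∈ i.1.1 then ((i.2 : ℤ) : ℝ) else 0) * B x y) 0 := by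
  have : Nonempty S.powerset := (powerset_nonempty S).coe_sort
  have hsum (U : Finset α) (W : Finset β) (s : ℤˣ) :
      ∑ y ∈ W, ((s : ℤ) : ℝ) * ∑ x ∈ U, B x y = ((s : ℤ) : ℝ) * ∑ x ∈ U, ∑ y ∈ W, B x y := by
    rw [← mul_sum, sum_comm]
  refine le_antisymm (cutNorm_le fun U hU W hW => ?_) (ciSup_le ?_)
  · obtain ⟨s, hs⟩ := exists_intUnit_mul_eq_abs (∑ x ∈ U, ∑ y ∈ W, B x y)
    rw [← hs, ← hsum]
    refine (sum_le_sum_max_zero _ hW).trans (le_trans (le_of_eq ?_)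
      (le_ciSup (Set.finite_range _).bddAbove (⟨U, mem_powerset.2 hU⟩, s)))
    simp only [sum_ite_mem_mul hU]
  · rintro ⟨⟨U, hU⟩, s⟩
    simp only [sum_ite_mem_mul (mem_powerset.1 hU), sum_max_zero, hsum]
    exact (intUnit_mul_le_abs _ _).trans
      (abs_sum_le_cutNorm B (mem_powerset.1 hU) (filter_subset _ _))

end CutNorm

section PartPerms

variable {V α : Type*} [DecidableEq V]

theorem expect_perm_coe_ciSup_matrix_le {ι : Type*} [Finite ι] [Nonempty ι] {S : Finset α}
    {T Y : Finset V} (hT : T ⊆ Y) {B : α → V → ℝ} (hB : ∀ x y, |B x y| ≤ 1) {c : ι → α → ℝ}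
    (hc : ∀ i x, |c i x| ≤ 1) {ψ : ℝ → ℝ} (hψ : ∀ a b, |ψ a - ψ b| ≤ |a - b|) :
    𝔼 τ : Perm Y, ⨆ i, ∑ y ∈ T, ψ (∑ x ∈ S, c i x * B x (Perm.ofSubtype τ y)) ≤
      #T / #Y * (⨆ i, ∑ y ∈ Y, ψ (∑ x ∈ S, c i x * B x y)) + 2 * (#S * √(#T)) := by
  have key := expect_perm_ciSup_matrix_le (S := S) (T.subtype (· ∈ Y))
    (fun x (y : Y) => hB x y) hc hψ
  have hcard : #(T.subtype (· ∈ Y)) = #T := by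
    rw [card_subtype, filter_true_of_mem fun _ h => hT h]
  have hsum (h : V → ℝ) (τ : Perm Y) :
      ∑ y ∈ T.subtype (· ∈ Y), h (τ y) = ∑ y ∈ T, h (Perm.ofSubtype τ y) := by
    simp [← sum_subtype_of_mem (fun y => h (Perm.ofSubtype τ y)) fun _ h => hT h]
  rw [hcard, Fintype.card_coe] at key
  simpa only [fun i τ => hsum (fun y => ψ (∑ x ∈ S, c i x * B x y)) τ,
    fun i => sum_coe_sort Y fun y => ψ (∑ x ∈ S, c i x * B x y)] using key

variable [Fintype V] {P : Finpartition (univ : Finset V)}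

/-- The permutations of `V` that map every part of `P` to itself. -/
def partPerms (P : Finpartition (univ : Finset V)) : Finset (Perm V) :=
  {σ | ∀ v, P.part (σ v) = P.part v}

theorem mem_partPerms {σ : Perm V} : σ ∈ partPerms P ↔ ∀ v, P.part (σ v) = P.part v := by
  simp [partPerms]

theorem partPerms_nonempty (P : Finpartition (univ : Finset V)) : (partPerms P).Nonempty :=
  ⟨1, by simp [mem_partPerms]⟩

theorem map_eq_of_mem_partPerms {σ : Perm V} (hσ : σ ∈ partPerms P) {X : Finset V}
    (hX : X ∈ P.parts) : X.map σ.toEmbedding = X := by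
  refine eq_of_subset_of_card_le (fun v hv => ?_) (by simp)
  obtain ⟨x, hx, rfl⟩ := mem_map.1 hv
  rw [← P.part_eq_iff_mem hX] at hx ⊢
  exact (mem_partPerms.1 hσ x).trans hx

theorem ofSubtype_mem_partPerms {X Y : Finset V} (hX : X ∈ P.parts) (hY : Y ⊆ X) (τ : Perm Y) :
    Perm.ofSubtype τ ∈ partPerms P := by
  refine mem_partPerms.2 fun v => ?_
  by_cases hv : v ∈ Y
  · rw [Perm.ofSubtype_apply_of_mem τ hv, (P.part_eq_iff_mem hX).2 (hY hv),
      (P.part_eq_iff_mem hX).2 (hY (τ ⟨v, hv⟩).2)]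
  · rw [Perm.ofSubtype_apply_of_not_mem τ hv]

theorem expect_partPerms_mul_right {θ : Perm V} (hθ : θ ∈ partPerms P) (F : Perm V → ℝ) :
    𝔼 σ ∈ partPerms P, F (σ * θ) = 𝔼 σ ∈ partPerms P, F σ := by
  refine expect_equiv (Equiv.mulRight θ) (fun σ => ?_) fun _ _ => rfl
  simp only [mem_partPerms, coe_mulRight, Perm.mul_apply] at hθ ⊢
  rw [← θ.forall_congr_right (q := fun v => P.part (σ v) = P.part v)]
  simp only [hθ]

theorem expect_partPerms_eq_expect_ofSubtype {X Y : Finset V} (hX : X ∈ P.parts) (hY : Y ⊆ X)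
    (F : Perm V → ℝ) :
    𝔼 σ ∈ partPerms P, F σ =
      𝔼 σ ∈ partPerms P, 𝔼 τ : Perm Y, F (σ * Perm.ofSubtype τ) := by
  rw [expect_comm]
  simp only [expect_partPerms_mul_right (ofSubtype_mem_partPerms hX hY _), Fintype.expect_const]

theorem expect_partPerms_ciSup_matrix_le {ι : Type*} [Finite ι] [Nonempty ι] {S : Finset α}
    {T X Y : Finset V} (hX : X ∈ P.parts) (hY : Y ⊆ X) (hT : T ⊆ Y) {B : Perm V → α → V → ℝ}
    (hB : ∀ σ x y, |B σ x y| ≤ 1)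
    (hBτ : ∀ σ (τ : Perm Y), ∀ x ∈ S, ∀ y,
      B (σ * Perm.ofSubtype τ) x y = B σ x (Perm.ofSubtype τ y))
    {c : ι → α → ℝ} (hc : ∀ i x, |c i x| ≤ 1) {ψ : ℝ → ℝ} (hψ : ∀ a b, |ψ a - ψ b| ≤ |a - b|) :
    𝔼 σ ∈ partPerms P, ⨆ i, ∑ y ∈ T, ψ (∑ x ∈ S, c i x * B σ x y) ≤
      #T / #Y * (𝔼 σ ∈ partPerms P, ⨆ i, ∑ y ∈ Y, ψ (∑ x ∈ S, c i x * B σ x y)) +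
        2 * (#S * √(#T)) := by
  have hmove (σ : Perm V) (τ : Perm Y) (i : ι) (y : V) :
      ∑ x ∈ S, c i x * B (σ * Perm.ofSubtype τ) x y =
        ∑ x ∈ S, c i x * B σ x (Perm.ofSubtype τ y) :=
    sum_congr rfl fun x hx => by rw [hBτ σ τ x hx]
  rw [expect_partPerms_eq_expect_ofSubtype hX hY, mul_expect,
    ← expect_const (partPerms_nonempty P) (2 * (#S * √(#T) : ℝ)), ← expect_add_distrib]
  simp only [hmove]
  refine expect_le_expect fun σ _ => ?_
  exact expect_perm_coe_ciSup_matrix_le hT (hB σ) hc hψ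

theorem expect_partPerms_cutNorm_le {S : Finset α} {T X Y : Finset V}
    (hX : X ∈ P.parts) (hY : Y ⊆ X) (hT : T ⊆ Y) {B : Perm V → α → V → ℝ}
    (hB : ∀ σ x y, |B σ x y| ≤ 1)
    (hBτ : ∀ σ (τ : Perm Y), ∀ x ∈ S, ∀ y,
      B (σ * Perm.ofSubtype τ) x y = B σ x (Perm.ofSubtype τ y)) :
    𝔼 σ ∈ partPerms P, cutNorm (B σ) S T ≤
      #T / #Y * (𝔼 σ ∈ partPerms P, cutNorm (B σ) S Y) + 2 * (#S * √(#T)) := by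
  classical
  have : Nonempty S.powerset := (powerset_nonempty S).coe_sort
  simp only [cutNorm_eq_ciSup]
  refine expect_partPerms_ciSup_matrix_le
    (c := fun (i : S.powerset × ℤˣ) x => if x ∈ i.1.1 then ((i.2 : ℤ) : ℝ) else 0)
    (ψ := fun z => max z 0) hX hY hT hB hBτ (fun i x => ?_) fun a b => abs_max_sub_max_le_abs a b 0
  rcases Int.units_eq_one_or i.2 with h | h <;> split_ifs <;> simp [h]

theorem expect_partPerms_abs_sum_le {S : Finset α} {T X Y : Finset V}
    (hX : X ∈ P.parts) (hY : Y ⊆ X) (hT : T ⊆ Y) {B : Perm V → α → V → ℝ}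
    (hB : ∀ σ x y, |B σ x y| ≤ 1)
    (hBτ : ∀ σ (τ : Perm Y), ∀ x ∈ S, ∀ y,
      B (σ * Perm.ofSubtype τ) x y = B σ x (Perm.ofSubtype τ y)) :
    𝔼 σ ∈ partPerms P, |∑ x ∈ S, ∑ y ∈ T, B σ x y| ≤
      #T / #Y * (𝔼 σ ∈ partPerms P, |∑ x ∈ S, ∑ y ∈ Y, B σ x y|) + 2 * (#S * √(#T)) := by
  have habs (W : Finset V) (σ : Perm V) : |∑ x ∈ S, ∑ y ∈ W, B σ x y| =
      ⨆ s : ℤˣ, ∑ y ∈ W, ∑ x ∈ S, ((s : ℤ) : ℝ) * B σ x y := by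
    simp only [sum_comm (s := S), ← mul_sum, ← abs_eq_ciSup_intUnit_mul]
  simp only [habs]
  refine expect_partPerms_ciSup_matrix_le (c := fun (s : ℤˣ) _ => ((s : ℤ) : ℝ)) (ψ := id)
    hX hY hT hB hBτ (fun s _ => ?_) fun _ _ => le_rfl
  rcases Int.units_eq_one_or s with rfl | rfl <;> simp

end PartPerms

section PartPermsMap

variable {V α : Type*} [Fintype V] [DecidableEq V] {P : Finpartition (univ : Finset V)}
  {S T X Y : Finset V}

theorem sum_comp_of_mem_partPerms {σ : Perm V} (hσ : σ ∈ partPerms P) (hX : X ∈ P.parts)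
    (f : V → ℝ) : ∑ x ∈ X, f (σ x) = ∑ x ∈ X, f x := by
  conv_rhs => rw [← map_eq_of_mem_partPerms hσ hX, sum_map]
  rfl

theorem expect_cutNorm_rows_le (hX : X ∈ P.parts) (hS : S ⊆ X) (T : Finset α) {A : V → α → ℝ}
    (hA : ∀ x y, |A x y| ≤ 1) :
    𝔼 σ ∈ partPerms P, cutNorm (fun x y => A (σ x) y) S T ≤
      #S / #X * cutNorm A X T + 2 * (#T * √(#S)) := by
  have hfull : ∀ σ ∈ partPerms P, cutNorm (fun y x => A (σ x) y) T X = cutNorm A X T := by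
    intro σ hσ
    rw [cutNorm_transpose fun x y => A (σ x) y]
    conv_rhs => rw [← map_eq_of_mem_partPerms hσ hX, ← map_refl (s := T), cutNorm_map]
    rfl
  have key := expect_partPerms_cutNorm_le (S := T) hX subset_rfl hS
    (B := fun σ y x => A (σ x) y) (fun _ _ _ => hA _ _) fun _ _ _ _ _ => rfl
  rw [expect_congr rfl hfull, expect_const (partPerms_nonempty P)] at key
  simpa only [fun σ : Perm V => cutNorm_transpose (fun x y => A (σ x) y) S T] using key

theorem expect_cutNorm_map_le (hX : X ∈ P.parts) (hY : Y ∈ P.parts) (hS : S ⊆ X) (hT : T ⊆ Y)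
    (hST : Disjoint S T) {A : V → V → ℝ} (hA : ∀ x y, |A x y| ≤ 1) :
    𝔼 σ ∈ partPerms P, cutNorm A (S.map σ.toEmbedding) (T.map σ.toEmbedding) ≤
      #T / #(Y \ S) * (#S / #X * cutNorm A X Y + 2 * (#Y * √(#S))) + 2 * (#S * √(#T)) := by
  have hcols : ∀ σ ∈ partPerms P, cutNorm (fun x y => A (σ x) (σ y)) S (Y \ S) ≤
      cutNorm (fun x y => A (σ x) y) S Y := by
    intro σ hσ
    refine (cutNorm_mono_right _ _ sdiff_subset).trans_eq ?_
    conv_rhs => rw [← map_eq_of_mem_partPerms hσ hY, ← map_refl (s := S), cutNorm_map]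
    rfl
  calc 𝔼 σ ∈ partPerms P, cutNorm A (S.map σ.toEmbedding) (T.map σ.toEmbedding)
      = 𝔼 σ ∈ partPerms P, cutNorm (fun x y => A (σ x) (σ y)) S T := by
        simp only [cutNorm_map, coe_toEmbedding]
    _ ≤ #T / #(Y \ S) * (𝔼 σ ∈ partPerms P, cutNorm (fun x y => A (σ x) (σ y)) S (Y \ S)) +
          2 * (#S * √(#T)) :=
        expect_partPerms_cutNorm_le hY sdiff_subset (subset_sdiff.2 ⟨hT, hST.symm⟩)
          (B := fun σ x y => A (σ x) (σ y)) (fun _ _ _ => hA _ _) fun σ τ x hx y => by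
            rw [Perm.mul_apply, Perm.mul_apply,
              Perm.ofSubtype_apply_of_not_mem τ (disjoint_left.1 disjoint_sdiff hx)]
    _ ≤ _ := by
        gcongr
        exact (expect_le_expect hcols).trans (expect_cutNorm_rows_le hX hS Y hA)

theorem expect_abs_sum_rows_le (hX : X ∈ P.parts) (hS : S ⊆ X) (T : Finset α) {A : V → α → ℝ}
    (hA : ∀ x y, |A x y| ≤ 1) :
    𝔼 σ ∈ partPerms P, |∑ x ∈ S, ∑ y ∈ T, A (σ x) y| ≤
      #S / #X * |∑ x ∈ X, ∑ y ∈ T, A x y| + 2 * (#T * √(#S)) := by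
  have hfull : ∀ σ ∈ partPerms P, |∑ y ∈ T, ∑ x ∈ X, A (σ x) y| = |∑ x ∈ X, ∑ y ∈ T, A x y| := by
    intro σ hσ
    rw [sum_comm, sum_comp_of_mem_partPerms hσ hX fun x => ∑ y ∈ T, A x y]
  have key := expect_partPerms_abs_sum_le (S := T) hX subset_rfl hS
    (B := fun σ y x => A (σ x) y) (fun _ _ _ => hA _ _) fun _ _ _ _ _ => rfl
  rw [expect_congr rfl hfull, expect_const (partPerms_nonempty P)] at key
  simpa only [sum_comm (s := T)] using key

theorem abs_sum_sum_le_card_mul_card {β : Type*} (S : Finset α) (T : Finset β) {A : α → β → ℝ}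
    (hA : ∀ x y, |A x y| ≤ 1) : |∑ x ∈ S, ∑ y ∈ T, A x y| ≤ #S * #T := by
  rw [← sum_product']
  calc |∑ p ∈ S ×ˢ T, A p.1 p.2| ≤ ∑ p ∈ S ×ˢ T, |A p.1 p.2| := abs_sum_le_sum_abs _ _
    _ ≤ #(S ×ˢ T) • (1 : ℝ) := sum_le_card_nsmul _ _ _ fun p _ => hA p.1 p.2
    _ = #S * #T := by simp

theorem expect_abs_sum_map_le (hX : X ∈ P.parts) (hY : Y ∈ P.parts) (hS : S ⊆ X) (hT : T ⊆ Y)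
    (hST : Disjoint S T) {A : V → V → ℝ} (hA : ∀ x y, |A x y| ≤ 1) :
    𝔼 σ ∈ partPerms P, |∑ x ∈ S.map σ.toEmbedding, ∑ y ∈ T.map σ.toEmbedding, A x y| ≤
      #T / #(Y \ S) *
        (#S / #X * |∑ x ∈ X, ∑ y ∈ Y, A x y| + 2 * (#Y * √(#S)) + #S * #(S ∩ Y)) +
        2 * (#S * √(#T)) := by
  have hcols : ∀ σ ∈ partPerms P, |∑ x ∈ S, ∑ y ∈ Y \ S, A (σ x) (σ y)| ≤
      |∑ x ∈ S, ∑ y ∈ Y, A (σ x) y| + #S * #(S ∩ Y) := by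
    intro σ hσ
    have hsplit : ∑ x ∈ S, ∑ y ∈ Y \ S, A (σ x) (σ y) =
        ∑ x ∈ S, ∑ y ∈ Y, A (σ x) y - ∑ x ∈ S, ∑ y ∈ S ∩ Y, A (σ x) (σ y) := by
      rw [← sum_sub_distrib]
      refine sum_congr rfl fun x _ => ?_
      rw [← sum_comp_of_mem_partPerms hσ hY, inter_comm, ← sum_inter_add_sum_sdiff Y S]
      ring
    rw [hsplit]
    exact (abs_sub _ _).trans
      (add_le_add_right (abs_sum_sum_le_card_mul_card _ _ fun _ _ => hA _ _) _)
  calc 𝔼 σ ∈ partPerms P, |∑ x ∈ S.map σ.toEmbedding, ∑ y ∈ T.map σ.toEmbedding, A x y|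
      = 𝔼 σ ∈ partPerms P, |∑ x ∈ S, ∑ y ∈ T, A (σ x) (σ y)| := by
        simp only [sum_map, coe_toEmbedding]
    _ ≤ #T / #(Y \ S) * (𝔼 σ ∈ partPerms P, |∑ x ∈ S, ∑ y ∈ Y \ S, A (σ x) (σ y)|) +
          2 * (#S * √(#T)) :=
        expect_partPerms_abs_sum_le hY sdiff_subset (subset_sdiff.2 ⟨hT, hST.symm⟩)
          (B := fun σ x y => A (σ x) (σ y)) (fun _ _ _ => hA _ _) fun σ τ x hx y => by
            rw [Perm.mul_apply, Perm.mul_apply,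
              Perm.ofSubtype_apply_of_not_mem τ (disjoint_left.1 disjoint_sdiff hx)]
    _ ≤ _ := by
        gcongr
        refine (expect_le_expect hcols).trans ?_
        rw [expect_add_distrib, expect_const (partPerms_nonempty P)]
        exact add_le_add_left (expect_abs_sum_rows_le hX hS Y hA) _

end PartPermsMap

section PairIrreg

variable {V : Type*} (G : SimpleGraph V) [DecidableRel G.Adj]

/-- The adjacency matrix of `G` with `d` subtracted from each entry. If `d` is the density of a
pair `(X, Y)`, its cut norm on `X × Y` is the irregularity of the pair. -/
noncomputable def shiftedAdj (d : ℝ) (x y : V) : ℝ := (if G.Adj x y then 1 else 0) - d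

theorem abs_shiftedAdj_edgeDensity_le (X Y : Finset V) (x y : V) :
    |shiftedAdj G (G.edgeDensity X Y) x y| ≤ 1 := by
  have h₀ : (0 : ℝ) ≤ G.edgeDensity X Y := mod_cast G.edgeDensity_nonneg X Y
  have h₁ : (G.edgeDensity X Y : ℝ) ≤ 1 := mod_cast G.edgeDensity_le_one X Y
  unfold shiftedAdj
  split_ifs <;> rw [abs_le] <;> constructor <;> linarith

theorem sum_shiftedAdj (d : ℝ) (U W : Finset V) :
    ∑ x ∈ U, ∑ y ∈ W, shiftedAdj G d x y = #(G.interedges U W) - #U * #W * d := by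
  simp only [shiftedAdj, sum_sub_distrib, sum_const, nsmul_eq_mul]
  rw [SimpleGraph.interedges_def, card_filter, sum_product]
  push_cast
  ring

theorem card_mul_card_mul_edgeDensity (X Y : Finset V) :
    (#X * #Y * G.edgeDensity X Y : ℝ) = #(G.interedges X Y) := by
  rcases X.eq_empty_or_nonempty with rfl | hX
  · simp [SimpleGraph.interedges_def]
  rcases Y.eq_empty_or_nonempty with rfl | hY
  · simp [SimpleGraph.interedges_def]
  have hX₀ : (#X : ℝ) ≠ 0 := mod_cast hX.card_ne_zero
  have hY₀ : (#Y : ℝ) ≠ 0 := mod_cast hY.card_ne_zero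
  rw [SimpleGraph.edgeDensity_def]
  push_cast
  field_simp

theorem pairIrreg_eq_cutNorm (X Y : Finset V) :
    G.pairIrreg X Y = cutNorm (shiftedAdj G (G.edgeDensity X Y)) X Y := by
  simp only [SimpleGraph.pairIrreg, cutNorm, sum_shiftedAdj]

theorem pairIrreg_nonneg (X Y : Finset V) : 0 ≤ G.pairIrreg X Y := by
  rw [pairIrreg_eq_cutNorm]
  exact (abs_nonneg _).trans (abs_sum_le_cutNorm _ subset_rfl subset_rfl)

theorem abs_sub_mul_le_quarter {N d u e : ℝ} (hd₀ : 0 ≤ d) (hd₁ : d ≤ 1) (he : 0 ≤ e)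
    (heu : e ≤ u) (heN : e ≤ N * d) (hueN : u - e ≤ N * (1 - d)) : |e - u * d| ≤ N / 4 := by
  have hN : 0 ≤ N := by linarith
  have hquarter : N * (d * (1 - d)) ≤ N / 4 := by nlinarith [mul_nonneg hN (sq_nonneg (2 * d - 1))]
  refine abs_sub_le_iff.2 ⟨?_, ?_⟩
  · calc e - u * d ≤ e * (1 - d) := by nlinarith
      _ ≤ N * d * (1 - d) := mul_le_mul_of_nonneg_right heN (sub_nonneg.2 hd₁)
      _ ≤ N / 4 := by linarith
  · calc u * d - e ≤ (u - e) * d := by nlinarith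
      _ ≤ N * (1 - d) * d := mul_le_mul_of_nonneg_right hueN hd₀
      _ ≤ N / 4 := by linarith

theorem card_mul_card_sub_card_interedges_mono {X Y U W : Finset V} (hU : U ⊆ X) (hW : W ⊆ Y) :
    (#U * #W - #(G.interedges U W) : ℝ) ≤ #X * #Y - #(G.interedges X Y) := by
  have hcompl (U W : Finset V) :
      (#U * #W - #(G.interedges U W) : ℝ) = #(Rel.interedges (fun x y => ¬G.Adj x y) U W) := by
    rw [sub_eq_iff_eq_add', SimpleGraph.interedges]
    exact mod_cast (Rel.card_interedges_add_card_interedges_compl G.Adj U W).symm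
  rw [hcompl, hcompl]
  exact mod_cast card_le_card (Rel.interedges_mono hU hW)

theorem pairIrreg_le_card_mul_card_div_four (X Y : Finset V) :
    G.pairIrreg X Y ≤ #X * #Y / 4 := by
  rw [pairIrreg_eq_cutNorm]
  refine cutNorm_le fun U hU W hW => ?_
  rw [sum_shiftedAdj]
  refine abs_sub_mul_le_quarter (mod_cast G.edgeDensity_nonneg X Y)
    (mod_cast G.edgeDensity_le_one X Y) (Nat.cast_nonneg _)
    (mod_cast G.card_interedges_le_mul U W) ?_ ?_
  · rw [card_mul_card_mul_edgeDensity]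
    exact mod_cast card_le_card (G.interedges_mono hU hW)
  · rw [mul_one_sub, card_mul_card_mul_edgeDensity]
    exact card_mul_card_sub_card_interedges_mono G hU hW

theorem pairIrreg_le_cutNorm_shiftedAdj_add (X Y : Finset V) (d : ℝ) :
    G.pairIrreg X Y ≤
      cutNorm (shiftedAdj G d) X Y + |∑ x ∈ X, ∑ y ∈ Y, shiftedAdj G d x y| := by
  rw [pairIrreg_eq_cutNorm]
  refine cutNorm_le fun U hU W hW => ?_
  have hle : (#U * #W : ℝ) ≤ #X * #Y := by gcongr
  have hshift : ∑ x ∈ U, ∑ y ∈ W, shiftedAdj G (G.edgeDensity X Y) x y =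
      ∑ x ∈ U, ∑ y ∈ W, shiftedAdj G d x y -
        #U * #W / (#X * #Y) * ∑ x ∈ X, ∑ y ∈ Y, shiftedAdj G d x y := by
    simp only [sum_shiftedAdj]
    rw [← card_mul_card_mul_edgeDensity G X Y]
    rcases eq_or_ne (#X * #Y : ℝ) 0 with h | h
    · simp [h, le_antisymm (h ▸ hle) (by positivity)]
    · rw [← mul_sub, div_mul_eq_mul_div, mul_left_comm, mul_div_cancel_left₀ _ h]
      ring
  calc |∑ x ∈ U, ∑ y ∈ W, shiftedAdj G (G.edgeDensity X Y) x y|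
      ≤ |∑ x ∈ U, ∑ y ∈ W, shiftedAdj G d x y| +
        |#U * #W / (#X * #Y) * ∑ x ∈ X, ∑ y ∈ Y, shiftedAdj G d x y| := by
        rw [hshift]
        exact abs_sub _ _
    _ ≤ _ := by
        rw [abs_mul, abs_of_nonneg (by positivity : (0 : ℝ) ≤ #U * #W / (#X * #Y))]
        exact add_le_add (abs_sum_le_cutNorm _ hU hW) <|
          mul_le_of_le_one_left (abs_nonneg _) (div_le_one_of_le₀ hle (by positivity))

variable [Fintype V] [DecidableEq V] {P : Finpartition (univ : Finset V)} {S T X Y : Finset V}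

/-- The expected irregularity of the image of the pair `(S, T)` under a uniformly random
permutation preserving each part of `P`. -/
noncomputable def meanPairIrreg (P : Finpartition (univ : Finset V)) (S T : Finset V) : ℝ :=
  𝔼 σ ∈ partPerms P, G.pairIrreg (S.map σ.toEmbedding) (T.map σ.toEmbedding)

theorem meanPairIrreg_le (hX : X ∈ P.parts) (hY : Y ∈ P.parts) (hS : S ⊆ X) (hT : T ⊆ Y)
    (hST : Disjoint S T) :
    meanPairIrreg G P S T ≤
      #T / #(Y \ S) * (#S / #X * G.pairIrreg X Y + 4 * (#Y * √(#S)) + #S * #(S ∩ Y)) +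
        4 * (#S * √(#T)) := by
  set A := shiftedAdj G (G.edgeDensity X Y)
  have hA : ∀ x y, |A x y| ≤ 1 := abs_shiftedAdj_edgeDensity_le G X Y
  have hmean : ∑ x ∈ X, ∑ y ∈ Y, A x y = 0 := by
    rw [sum_shiftedAdj, card_mul_card_mul_edgeDensity, sub_self]
  have hcut := expect_cutNorm_map_le hX hY hS hT hST hA
  have hsum := expect_abs_sum_map_le hX hY hS hT hST hA
  rw [hmean, abs_zero, mul_zero, zero_add] at hsum
  calc meanPairIrreg G P S T
      ≤ 𝔼 σ ∈ partPerms P, (cutNorm A (S.map σ.toEmbedding) (T.map σ.toEmbedding) +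
          |∑ x ∈ S.map σ.toEmbedding, ∑ y ∈ T.map σ.toEmbedding, A x y|) :=
        expect_le_expect fun σ _ => pairIrreg_le_cutNorm_shiftedAdj_add G _ _ _
    _ ≤ _ := by
        rw [expect_add_distrib]
        refine (add_le_add hcut hsum).trans_eq ?_
        rw [pairIrreg_eq_cutNorm]
        ring

theorem meanPairIrreg_le_card_mul_card_div_four (P : Finpartition (univ : Finset V))
    (S T : Finset V) : meanPairIrreg G P S T ≤ #S * #T / 4 :=
  expect_le (partPerms_nonempty P) fun σ _ => by
    simpa only [card_map] using
      pairIrreg_le_card_mul_card_div_four G (S.map σ.toEmbedding) (T.map σ.toEmbedding)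

end PairIrreg

section PartsWithin

variable {V : Type*} [DecidableEq V] {a : Finset V} (P Q : Finpartition a)

/-- The parts of `Q` contained in `X`. -/
def partsWithin (X : Finset V) : Finset (Finset V) := {S ∈ Q.parts | S ⊆ X}

/-- The parts of `Q` contained in no part of `P`: these obstruct `Q` from refining `P`. -/
def crossingParts : Finset (Finset V) := {S ∈ Q.parts | ¬∃ X ∈ P.parts, S ⊆ X}

variable {P Q}

theorem mem_partsWithin {S X : Finset V} : S ∈ partsWithin Q X ↔ S ∈ Q.parts ∧ S ⊆ X := mem_filter

theorem sum_parts_eq_sum_partsWithin_add_sum_crossingParts (P Q : Finpartition a)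
    (h : Finset V → ℝ) :
    ∑ S ∈ Q.parts, h S =
      ∑ X ∈ P.parts, ∑ S ∈ partsWithin Q X, h S + ∑ S ∈ crossingParts P Q, h S := by
  have hdisj : (P.parts : Set (Finset V)).PairwiseDisjoint (partsWithin Q) := by
    refine fun X hX Y hY hXY => disjoint_left.2 fun S hSX hSY => ?_
    obtain ⟨hSQ, hSX⟩ := mem_partsWithin.1 hSX
    obtain ⟨v, hv⟩ := Q.nonempty_of_mem_parts hSQ
    exact hXY (P.eq_of_mem_parts hX hY (hSX hv) ((mem_partsWithin.1 hSY).2 hv))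
  have hunion : P.parts.biUnion (partsWithin Q) = {S ∈ Q.parts | ∃ X ∈ P.parts, S ⊆ X} := by
    ext S
    simp only [mem_biUnion, mem_partsWithin, mem_filter]
    tauto
  rw [← sum_biUnion hdisj, hunion]
  exact (sum_filter_add_sum_filter_not _ _ _).symm

theorem sum_card_inter_le {𝒮 : Finset (Finset V)} (h𝒮 : 𝒮 ⊆ Q.parts) {Z : Finset V}
    (hZ : ∀ S ∈ 𝒮, S ⊆ Z) (Y : Finset V) : ∑ S ∈ 𝒮, #(S ∩ Y) ≤ #(Z ∩ Y) := by
  rw [← card_biUnion (t := (· ∩ Y)) fun S hS T hT hST =>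
    (Q.disjoint (h𝒮 hS) (h𝒮 hT) hST).mono inter_subset_left inter_subset_left]
  exact card_le_card (biUnion_subset.2 fun S hS => inter_subset_inter_right (hZ S hS))

theorem sum_card_le_of_subset_parts {𝒮 : Finset (Finset V)} (h𝒮 : 𝒮 ⊆ Q.parts) {Z : Finset V}
    (hZ : ∀ S ∈ 𝒮, S ⊆ Z) : ∑ S ∈ 𝒮, #S ≤ #Z := by
  have h := sum_card_inter_le h𝒮 hZ Z
  rwa [inter_self, sum_congr rfl fun S hS => by rw [inter_eq_left.2 (hZ S hS)]] at h

theorem sum_card_crossingParts_le {s : ℕ}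
    (h : ∀ X ∈ P.parts, #(X \ (partsWithin Q X).biUnion id) ≤ s) :
    ∑ S ∈ crossingParts P Q, #S ≤ #P.parts * s := by
  refine (sum_card_le_of_subset_parts (filter_subset _ _)
    (Z := P.parts.biUnion fun X => X \ (partsWithin Q X).biUnion id) fun S hS v hv => ?_).trans
    (card_biUnion_le_card_mul _ _ _ h)
  obtain ⟨hSQ, hSP⟩ := mem_filter.1 hS
  obtain ⟨X, hX, hvX⟩ := P.exists_mem (Q.le hSQ hv)
  refine mem_biUnion.2 ⟨X, hX, mem_sdiff.2 ⟨hvX, fun hv' => hSP ⟨X, hX, ?_⟩⟩⟩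
  obtain ⟨T, hT, hvT⟩ := mem_biUnion.1 hv'
  obtain ⟨hTQ, hTX⟩ := mem_partsWithin.1 hT
  rwa [Q.eq_of_mem_parts hSQ hTQ hv hvT]

theorem sum_sum_parts_le_add_sum_card_crossingParts (P Q : Finpartition a)
    {E : Finset V → Finset V → ℝ} (hE : ∀ S T, E S T ≤ #S * #T / 4) :
    ∑ S ∈ Q.parts, ∑ T ∈ Q.parts, E S T ≤
      ∑ X ∈ P.parts, ∑ Y ∈ P.parts, ∑ S ∈ partsWithin Q X, ∑ T ∈ partsWithin Q Y, E S T +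
        (∑ S ∈ crossingParts P Q, (#S : ℝ)) * #a / 2 := by
  set r : ℝ := ∑ S ∈ crossingParts P Q, (#S : ℝ) with hr
  have hcardQ : ∑ S ∈ Q.parts, (#S : ℝ) = #a := mod_cast Q.sum_card_parts
  have hcross (S : Finset V) : ∑ T ∈ Q.parts, E S T ≤
      ∑ Y ∈ P.parts, ∑ T ∈ partsWithin Q Y, E S T + #S * r / 4 := by
    rw [sum_parts_eq_sum_partsWithin_add_sum_crossingParts P Q (E S), hr, mul_sum, sum_div]
    exact add_le_add_right (sum_le_sum fun T _ => hE S T) _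
  have hrow (S : Finset V) : ∑ T ∈ Q.parts, E S T ≤ #S * #a / 4 := by
    rw [← hcardQ, mul_sum, sum_div]
    exact sum_le_sum fun T _ => hE S T
  have hwithin : ∑ X ∈ P.parts, ∑ S ∈ partsWithin Q X, (#S : ℝ) ≤ #a := by
    rw [← hcardQ, sum_parts_eq_sum_partsWithin_add_sum_crossingParts P Q]
    exact le_add_of_nonneg_right (sum_nonneg fun S _ => Nat.cast_nonneg _)
  calc ∑ S ∈ Q.parts, ∑ T ∈ Q.parts, E S T
      = ∑ X ∈ P.parts, ∑ S ∈ partsWithin Q X, ∑ T ∈ Q.parts, E S T +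
          ∑ S ∈ crossingParts P Q, ∑ T ∈ Q.parts, E S T :=
        sum_parts_eq_sum_partsWithin_add_sum_crossingParts P Q _
    _ ≤ ∑ X ∈ P.parts, ∑ S ∈ partsWithin Q X,
            (∑ Y ∈ P.parts, ∑ T ∈ partsWithin Q Y, E S T + #S * r / 4) +
          ∑ S ∈ crossingParts P Q, #S * (#a : ℝ) / 4 := by
        gcongr with X _ S _ S _
        exacts [hcross S, hrow S]
    _ = ∑ X ∈ P.parts, ∑ Y ∈ P.parts, ∑ S ∈ partsWithin Q X, ∑ T ∈ partsWithin Q Y, E S T +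
          (∑ X ∈ P.parts, ∑ S ∈ partsWithin Q X, (#S : ℝ)) * r / 4 + r * #a / 4 := by
        simp only [sum_add_distrib, ← sum_div, ← sum_mul, ← hr]
        rw [sum_congr rfl fun X _ => sum_comm]
    _ ≤ _ := by
        have hr₀ : 0 ≤ r := sum_nonneg fun S _ => Nat.cast_nonneg _
        linarith [mul_le_mul_of_nonneg_right hwithin hr₀]

theorem sum_sum_card_inter (P : Finpartition a) :
    ∑ X ∈ P.parts, ∑ Y ∈ P.parts, #(X ∩ Y) = #a := by
  rw [← P.sum_card_parts]
  refine sum_congr rfl fun X hX => ?_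
  rw [sum_eq_single_of_mem X hX, inter_self]
  exact fun Y hY hYX => card_eq_zero.2 (disjoint_iff_inter_eq_empty.1 (P.disjoint hX hY hYX.symm))

end PartsWithin

section RandomRefinement

variable {V : Type*} [Fintype V] [DecidableEq V] (G : SimpleGraph V) [DecidableRel G.Adj]
  {P Q : Finpartition (univ : Finset V)} {S X Y : Finset V} {δ t : ℝ}

theorem sum_meanPairIrreg_erase_le (hX : X ∈ P.parts) (hY : Y ∈ P.parts) (hSQ : S ∈ Q.parts)
    (hSX : S ⊆ X) (ht : ∀ S ∈ Q.parts, #S ≤ t) (hδ₀ : 0 ≤ δ)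
    (hδ : ∀ S ∈ Q.parts, √(#S) ≤ δ * #S) :
    ∑ T ∈ (partsWithin Q Y).erase S, meanPairIrreg G P S T ≤
      #S / #X * G.pairIrreg X Y + 8 * δ * (#S * #Y) + t * #(S ∩ Y) := by
  have hirreg := pairIrreg_nonneg G X Y
  have hcard : ∑ T ∈ (partsWithin Q Y).erase S, (#T : ℝ) ≤ #(Y \ S) :=
    mod_cast sum_card_le_of_subset_parts ((erase_subset _ _).trans (filter_subset _ _))
      fun T hT => by
        obtain ⟨hTS, hT⟩ := mem_erase.1 hT
        obtain ⟨hTQ, hTY⟩ := mem_partsWithin.1 hT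
        exact subset_sdiff.2 ⟨hTY, Q.disjoint hTQ hSQ hTS⟩
  have hsqrt : ∑ T ∈ (partsWithin Q Y).erase S, √(#T) ≤ δ * #Y :=
    calc ∑ T ∈ (partsWithin Q Y).erase S, √(#T)
        ≤ ∑ T ∈ (partsWithin Q Y).erase S, δ * #T :=
          sum_le_sum fun T hT => hδ T (mem_partsWithin.1 (mem_of_mem_erase hT)).1
      _ ≤ δ * #Y := by
          rw [← mul_sum]
          gcongr
          exact hcard.trans (mod_cast card_le_card sdiff_subset)
  calc ∑ T ∈ (partsWithin Q Y).erase S, meanPairIrreg G P S T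
      ≤ ∑ T ∈ (partsWithin Q Y).erase S, (#T / #(Y \ S) *
          (#S / #X * G.pairIrreg X Y + 4 * (#Y * √(#S)) + #S * #(S ∩ Y)) + 4 * (#S * √(#T))) :=
        sum_le_sum fun T hT => by
          obtain ⟨hTS, hT⟩ := mem_erase.1 hT
          obtain ⟨hTQ, hTY⟩ := mem_partsWithin.1 hT
          exact meanPairIrreg_le G hX hY hSX hTY (Q.disjoint hSQ hTQ hTS.symm)
    _ = (∑ T ∈ (partsWithin Q Y).erase S, (#T : ℝ)) / #(Y \ S) *
          (#S / #X * G.pairIrreg X Y + 4 * (#Y * √(#S)) + #S * #(S ∩ Y)) +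
          4 * (#S * ∑ T ∈ (partsWithin Q Y).erase S, √(#T)) := by
        rw [sum_add_distrib, ← sum_mul, ← sum_div, ← mul_sum, ← mul_sum]
    _ ≤ 1 * (#S / #X * G.pairIrreg X Y + 4 * (#Y * (δ * #S)) + t * #(S ∩ Y)) +
          4 * (#S * (δ * #Y)) := by
        gcongr
        exacts [div_le_one_of_le₀ hcard (by positivity), hδ S hSQ, ht S hSQ]
    _ = _ := by ring

theorem sum_meanPairIrreg_le (hX : X ∈ P.parts) (hY : Y ∈ P.parts) (hSQ : S ∈ Q.parts)
    (hSX : S ⊆ X) (ht : ∀ S ∈ Q.parts, #S ≤ t) (hδ₀ : 0 ≤ δ)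
    (hδ : ∀ S ∈ Q.parts, √(#S) ≤ δ * #S) :
    ∑ T ∈ partsWithin Q Y, meanPairIrreg G P S T ≤
      #S / #X * G.pairIrreg X Y + 8 * δ * (#S * #Y) + 5 / 4 * t * #(S ∩ Y) := by
  have herase := sum_meanPairIrreg_erase_le G hX hY hSQ hSX ht hδ₀ hδ
  by_cases hSY : S ∈ partsWithin Q Y
  · have hdiag : meanPairIrreg G P S S ≤ t * #(S ∩ Y) / 4 := by
      rw [inter_eq_left.2 (mem_partsWithin.1 hSY).2]
      refine (meanPairIrreg_le_card_mul_card_div_four G P S S).trans ?_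
      gcongr
      exact ht S hSQ
    rw [← add_sum_erase _ _ hSY]
    linarith
  · have ht₀ : 0 ≤ t * #(S ∩ Y) :=
      mul_nonneg ((Nat.cast_nonneg _).trans (ht S hSQ)) (Nat.cast_nonneg _)
    rw [erase_eq_of_notMem hSY] at herase
    linarith

theorem sum_sum_meanPairIrreg_le (hX : X ∈ P.parts) (hY : Y ∈ P.parts) (ht₀ : 0 ≤ t)
    (ht : ∀ S ∈ Q.parts, #S ≤ t) (hδ₀ : 0 ≤ δ) (hδ : ∀ S ∈ Q.parts, √(#S) ≤ δ * #S) :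
    ∑ S ∈ partsWithin Q X, ∑ T ∈ partsWithin Q Y, meanPairIrreg G P S T ≤
      G.pairIrreg X Y + 8 * δ * (#X * #Y) + 5 / 4 * t * #(X ∩ Y) := by
  have hirreg := pairIrreg_nonneg G X Y
  have hsub : ∀ S ∈ partsWithin Q X, S ⊆ X := fun S hS => (mem_partsWithin.1 hS).2
  have hcard : ∑ S ∈ partsWithin Q X, (#S : ℝ) ≤ #X :=
    mod_cast sum_card_le_of_subset_parts (filter_subset _ _) hsub
  have hinter : ∑ S ∈ partsWithin Q X, (#(S ∩ Y) : ℝ) ≤ #(X ∩ Y) :=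
    mod_cast sum_card_inter_le (filter_subset _ _) hsub Y
  calc ∑ S ∈ partsWithin Q X, ∑ T ∈ partsWithin Q Y, meanPairIrreg G P S T
      ≤ ∑ S ∈ partsWithin Q X,
          (#S / #X * G.pairIrreg X Y + 8 * δ * (#S * #Y) + 5 / 4 * t * #(S ∩ Y)) :=
        sum_le_sum fun S hS => sum_meanPairIrreg_le G hX hY (mem_partsWithin.1 hS).1
          (hsub S hS) ht hδ₀ hδ
    _ = (∑ S ∈ partsWithin Q X, (#S : ℝ)) / #X * G.pairIrreg X Y +
          8 * δ * ((∑ S ∈ partsWithin Q X, (#S : ℝ)) * #Y) +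
          5 / 4 * t * ∑ S ∈ partsWithin Q X, (#(S ∩ Y) : ℝ) := by
        rw [sum_add_distrib, sum_add_distrib, ← sum_mul, ← sum_div, ← mul_sum, ← sum_mul,
          ← mul_sum]
    _ ≤ 1 * G.pairIrreg X Y + 8 * δ * (#X * #Y) + 5 / 4 * t * #(X ∩ Y) := by
        gcongr
        exact div_le_one_of_le₀ hcard (by positivity)
    _ = _ := by rw [one_mul]

/-- The image of a vertex partition under a permutation of the vertices. -/
def mapPerm (σ : Perm V) (Q : Finpartition (univ : Finset V)) : Finpartition (univ : Finset V) :=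
  (Q.map (β := Finset V) ⟨σ.finsetCongr, map_subset_map⟩).copy (map_univ_equiv σ)

theorem mapPerm_parts (σ : Perm V) (Q : Finpartition (univ : Finset V)) :
    (mapPerm σ Q).parts = Q.parts.map (mapEmbedding σ.toEmbedding).toEmbedding :=
  rfl

theorem partitionIrreg_mapPerm (σ : Perm V) (Q : Finpartition (univ : Finset V)) :
    G.partitionIrreg (mapPerm σ Q) = ∑ S ∈ Q.parts, ∑ T ∈ Q.parts,
      G.pairIrreg (S.map σ.toEmbedding) (T.map σ.toEmbedding) := by
  simp [SimpleGraph.partitionIrreg, mapPerm_parts]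

theorem isEquipartition_mapPerm (σ : Perm V) (hQ : Q.IsEquipartition) :
    (mapPerm σ Q).IsEquipartition := by
  obtain ⟨s, hs⟩ := Set.equitableOn_iff_exists_eq_eq_add_one.1 hQ
  refine Set.equitableOn_iff_exists_eq_eq_add_one.2 ⟨s, fun S hS => ?_⟩
  obtain ⟨T, hT, rfl⟩ := mem_map.1 hS
  exact (card_map σ.toEmbedding).symm ▸ hs T hT

theorem expect_partitionIrreg_mapPerm_le (P : Finpartition (univ : Finset V)) (ht₀ : 0 ≤ t)
    (ht : ∀ S ∈ Q.parts, #S ≤ t) (hδ₀ : 0 ≤ δ) (hδ : ∀ S ∈ Q.parts, √(#S) ≤ δ * #S) :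
    𝔼 σ ∈ partPerms P, G.partitionIrreg (mapPerm σ Q) ≤
      G.partitionIrreg P + 8 * δ * Fintype.card V ^ 2 + 5 / 4 * t * Fintype.card V +
        (∑ S ∈ crossingParts P Q, (#S : ℝ)) * Fintype.card V / 2 := by
  have hcardP : ∑ X ∈ P.parts, (#X : ℝ) = Fintype.card V := mod_cast P.sum_card_parts
  have hinter : ∑ X ∈ P.parts, ∑ Y ∈ P.parts, (#(X ∩ Y) : ℝ) = Fintype.card V :=
    mod_cast sum_sum_card_inter P
  calc 𝔼 σ ∈ partPerms P, G.partitionIrreg (mapPerm σ Q)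
      = ∑ S ∈ Q.parts, ∑ T ∈ Q.parts, meanPairIrreg G P S T := by
        simp only [partitionIrreg_mapPerm, expect_sum_comm, meanPairIrreg]
    _ ≤ ∑ X ∈ P.parts, ∑ Y ∈ P.parts,
            ∑ S ∈ partsWithin Q X, ∑ T ∈ partsWithin Q Y, meanPairIrreg G P S T +
          (∑ S ∈ crossingParts P Q, (#S : ℝ)) * Fintype.card V / 2 :=
        sum_sum_parts_le_add_sum_card_crossingParts P Q
          (meanPairIrreg_le_card_mul_card_div_four G P)
    _ ≤ ∑ X ∈ P.parts, ∑ Y ∈ P.parts,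
            (G.pairIrreg X Y + 8 * δ * (#X * #Y) + 5 / 4 * t * #(X ∩ Y)) +
          (∑ S ∈ crossingParts P Q, (#S : ℝ)) * Fintype.card V / 2 := by
        gcongr with X hX Y hY
        exact sum_sum_meanPairIrreg_le G hX hY ht₀ ht hδ₀ hδ
    _ = _ := by
        simp only [sum_add_distrib, ← mul_sum, ← sum_mul, hcardP, hinter,
          SimpleGraph.partitionIrreg, sq]

theorem exists_isEquipartition_card_sdiff_le (P : Finpartition (univ : Finset V)) {K : ℕ}
    (hK : 0 < K) (hKV : K ≤ Fintype.card V) :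
    ∃ Q : Finpartition (univ : Finset V), Q.IsEquipartition ∧ #Q.parts = K ∧
      (∀ S ∈ Q.parts, #S = Fintype.card V / K ∨ #S = Fintype.card V / K + 1) ∧
      ∀ X ∈ P.parts, #(X \ (partsWithin Q X).biUnion id) ≤ Fintype.card V / K := by
  set s := Fintype.card V / K
  have hcard : (K - Fintype.card V % K) * s + Fintype.card V % K * (s + 1) =
      #(univ : Finset V) := by
    have hmod : K - Fintype.card V % K + Fintype.card V % K = K :=
      Nat.sub_add_cancel (Nat.mod_lt _ hK).le
    rw [mul_add_one, ← add_assoc, ← add_mul, hmod, card_univ]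
    exact Nat.div_add_mod _ _
  refine ⟨P.equitabilise hcard, Finpartition.equitabilise_isEquipartition, ?_,
    fun S => Finpartition.card_eq_of_mem_parts_equitabilise,
    fun X => P.card_parts_equitabilise_subset_le hcard⟩
  rw [P.card_parts_equitabilise hcard (Nat.div_pos hKV hK).ne']
  exact Nat.sub_add_cancel (Nat.mod_lt _ hK).le

theorem exists_isEquipartition_partitionIrreg_le (P : Finpartition (univ : Finset V)) {K s : ℕ}
    (hK : 0 < K) (hKV : K ≤ Fintype.card V) (hs : Fintype.card V / K = s) :
    ∃ Q : Finpartition (univ : Finset V), Q.IsEquipartition ∧ #Q.parts = K ∧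
      G.partitionIrreg Q ≤ G.partitionIrreg P + 8 / √s * Fintype.card V ^ 2 +
        5 / 4 * (s + 1) * Fintype.card V + #P.parts * s * Fintype.card V / 2 := by
  obtain ⟨Q, hQ, hQK, hQs, hsdiff⟩ := exists_isEquipartition_card_sdiff_le P hK hKV
  rw [hs] at hQs hsdiff
  have hs₀ : (0 : ℝ) < s := mod_cast hs ▸ Nat.div_pos hKV hK
  have ht : ∀ S ∈ Q.parts, (#S : ℝ) ≤ s + 1 := fun S hS => by
    have := hQs S hS
    exact_mod_cast (by lia : #S ≤ s + 1)
  have hδ : ∀ S ∈ Q.parts, √(#S) ≤ 1 / √s * #S := fun S hS => by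
    have hsS : √s ≤ √(#S) := by
      have := hQs S hS
      gcongr
      lia
    calc √(#S) = 1 / √s * (√s * √(#S)) := by field_simp
      _ ≤ 1 / √s * (√(#S) * √(#S)) := by gcongr
      _ = 1 / √s * #S := by rw [Real.mul_self_sqrt (Nat.cast_nonneg _)]
  obtain ⟨σ, -, hσ⟩ := exists_le_of_expect_le (partPerms_nonempty P)
    (expect_partitionIrreg_mapPerm_le G P (by positivity) ht (by positivity) hδ)
  refine ⟨mapPerm σ Q, isEquipartition_mapPerm σ hQ, by rw [mapPerm_parts, card_map, hQK],
    hσ.trans ?_⟩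
  rw [mul_one_div]
  gcongr
  exact_mod_cast sum_card_crossingParts_le hsdiff

end RandomRefinement

section Numerics

theorem three_quarters_mul_le_floor {x : ℝ} (hx : 4 ≤ x) : 3 / 4 * x ≤ ⌊x⌋₊ := by
  have := Nat.lt_floor_add_one x
  linarith

theorem eight_div_sqrt_le {α s : ℝ} (hα : 0 < α) (hs : 1600 ≤ s * α ^ 2) : 8 / √s ≤ α / 5 := by
  have hsqrt : 40 ≤ √s * α := by
    rw [← Real.sqrt_sq hα.le, ← Real.sqrt_mul' _ (sq_nonneg α)]
    exact Real.le_sqrt_of_sq_le (by linarith)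
  have hs₀ : 0 < √s := by
    by_contra! h
    nlinarith
  rw [div_le_iff₀ hs₀]
  linarith

theorem le_mul_sq_of_mul_le {α n m K s : ℝ} (hα₀ : 0 < α) (hα₁ : α ≤ 1) (hm : 1 ≤ m)
    (hn : 10 ^ 4 * m ≤ n * α ^ 3) (hK : K * α ≤ 4 * m) (hs : n ≤ K * (s + 1)) (hs₀ : 0 ≤ s) :
    1600 ≤ s * α ^ 2 := by
  have hsucc : 4 * m * 2500 ≤ 4 * m * ((s + 1) * α ^ 2) :=
    calc 4 * m * 2500 = 10 ^ 4 * m := by ring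
      _ ≤ n * α ^ 3 := hn
      _ ≤ K * (s + 1) * α ^ 3 := by gcongr
      _ = K * α * ((s + 1) * α ^ 2) := by ring
      _ ≤ 4 * m * ((s + 1) * α ^ 2) := by gcongr
  have := le_of_mul_le_mul_left hsucc (by positivity)
  nlinarith

theorem error_le {α n m K s : ℝ} (hα₀ : 0 < α) (hα₁ : α ≤ 1) (hm : 1 ≤ m)
    (hn : 10 ^ 4 * m ≤ n * α ^ 3) (hK : K * α ≤ 4 * m) (hK' : 3 * m ≤ K * α)
    (hs : n ≤ K * (s + 1)) (hs' : K * s ≤ n) (hs₀ : 0 ≤ s) :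
    8 / √s * n ^ 2 + 5 / 4 * (s + 1) * n + m * s * n / 2 ≤ α * n ^ 2 := by
  have hsqrt := eight_div_sqrt_le hα₀ (le_mul_sq_of_mul_le hα₀ hα₁ hm hn hK hs hs₀)
  have hn₀ : 0 ≤ n := by
    have : 0 < α ^ 3 := by positivity
    nlinarith
  have hms : m * s ≤ α * n / 3 := by nlinarith
  have hsm : s ≤ m * s := le_mul_of_one_le_left hs₀ hm
  have hαn : 10 ^ 4 ≤ α * n := by
    have : n * α ^ 3 ≤ n * α := by
      gcongr
      exact pow_le_of_le_one hα₀.le hα₁ (by norm_num)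
    linarith
  calc 8 / √s * n ^ 2 + 5 / 4 * (s + 1) * n + m * s * n / 2
      ≤ α / 5 * n ^ 2 + 5 / 4 * (α * n / 3 + α * n / 10 ^ 4) * n + α * n / 3 * n / 2 := by
        gcongr
        · linarith
        · linarith
    _ ≤ α * n ^ 2 := by nlinarith [mul_nonneg hα₀.le (sq_nonneg n)]

end Numerics

theorem theorem2p1_general {V : Type*} [Fintype V] [DecidableEq V] (G : SimpleGraph V)
    [DecidableRel G.Adj] {α : ℝ} (hα₀ : 0 < α) (hα₁ : α ≤ 1)
    (P : Finpartition (univ : Finset V)) (hn : 10 ^ 4 * #P.parts * (α ^ 3)⁻¹ ≤ Fintype.card V) :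
    ∃ Q : Finpartition (univ : Finset V), Q.IsEquipartition ∧ #Q.parts ≤ 4 * #P.parts / α ∧
      G.partitionIrreg Q ≤ G.partitionIrreg P + α * Fintype.card V ^ 2 := by
  rcases P.parts.eq_empty_or_nonempty with hP | hP
  · exact ⟨P, by simp [Finpartition.IsEquipartition, hP], by simp [hP],
      le_add_of_nonneg_right (by positivity)⟩
  have hm : (1 : ℝ) ≤ #P.parts := mod_cast hP.card_pos
  have hx : 4 ≤ 4 * #P.parts / α := by rw [le_div_iff₀ hα₀]; linarith
  rw [← div_eq_mul_inv, div_le_iff₀ (by positivity)] at hn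
  set K := ⌊4 * #P.parts / α⌋₊
  have hKle : (K : ℝ) ≤ 4 * #P.parts / α := Nat.floor_le (by positivity)
  have hKα : K * α ≤ 4 * #P.parts := (le_div_iff₀ hα₀).1 hKle
  have hKα' : 3 * #P.parts ≤ K * α := by
    have := three_quarters_mul_le_floor hx
    rw [← div_le_iff₀ hα₀]
    exact (by ring : 3 * #P.parts / α = 3 / 4 * (4 * #P.parts / α)).trans_le this
  have hK : 0 < K := Nat.floor_pos.2 (by linarith)
  have hs : (Fintype.card V : ℝ) ≤ K * ((Fintype.card V / K : ℕ) + 1) :=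
    mod_cast (Nat.lt_mul_div_succ _ hK).le
  have hs' : (K * (Fintype.card V / K : ℕ) : ℝ) ≤ Fintype.card V := mod_cast Nat.mul_div_le _ _
  have hKV : K ≤ Fintype.card V := by
    by_contra! h
    have := le_mul_sq_of_mul_le hα₀ hα₁ hm hn hKα hs (Nat.cast_nonneg _)
    norm_num [Nat.div_eq_of_lt h] at this
  obtain ⟨Q, hQ, hQK, hQP⟩ := exists_isEquipartition_partitionIrreg_le G P hK hKV rfl
  refine ⟨Q, hQ, hQK ▸ hKle, ?_⟩
  linarith [error_le hα₀ hα₁ hm hn hKα hKα' hs hs' (Nat.cast_nonneg _)]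

theorem theorem2p1 {V : Type*} [Fintype V] [DecidableEq V]
    (G : SimpleGraph V) [DecidableRel G.Adj] (α : ℝ) (hα₀ : 0 < α) (hα₁ : α < 1 / 2)
    (m : ℕ) (hm : 1 ≤ m)
    (hn : (10 : ℝ) ^ 8 * (m : ℝ) * (α ^ 5)⁻¹ ≤ (Fintype.card V : ℝ))
    (P : Finpartition (Finset.univ : Finset V)) (hP : P.parts.card = m) :
    ∃ Q : Finpartition (Finset.univ : Finset V),
      Q.IsEquipartition ∧
      (Q.parts.card : ℝ) ≤ 4 * (m : ℝ) / α ∧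
      G.partitionIrreg Q ≤ G.partitionIrreg P + α * (Fintype.card V : ℝ) ^ 2 := by
  subst hP
  refine theorem2p1_general G hα₀ (by linarith) P (hn.trans' ?_)
  gcongr 10 ^ ?_ * _ * (?_)⁻¹
  exacts [by norm_num, by norm_num, pow_le_pow_of_le_one hα₀.le (by linarith) (by norm_num)]
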